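/- Words are finite sequences of positive integers; concatenation is written by juxtaposition. Two words differ by a Knuth transposition if, in some order, they are either $x\,a\,c\,b\,y$ and $x\,c\,a\,b\,y$ with letters $a\le b<c$, or $x\,b\,a\,c\,y$ and $x\,b\,c\,a\,y$ with letters $a<b\le c$, where $x,y$ are words; words $v,w$ are Knuth-equivalent, $v\equiv w$, if one is obtained from the other by a finite sequence of Knuth transpositions. For a word $u$ let $C(u)=\{w \mid uw\equiv wu\}$, and for $n,m\in\mathbb{N}$ let $$c_{n,m}(u)=\#\{w\in C(u) \mid w \text{ has length } n \text{ and all letters of } w \text{ are at most } m\}.$$ **Theorem.** For the one-letter word $u=1$, for each $1\le n\le 8$ and all $m\ge n$, the number $c_{n,m}(1)$ is given by \begin{align*} c_{1,m}(1)&=1,\\ c_{2,m}(1)&=\binom m1,\\ c_{3,m}(1)&=\binom m1+\binom m2,\\ c_{4,m}(1)&=\binom m1+4\binom m2+\binom m3,\\ c_{5,m}(1)&=\binom m1+8\binom m2+13\binom m3+\binom m4,\\ c_{6,m}(1)&=\binom m1+18\binom m2+48\binom m3+41\binom m4+\binom m5,\\ c_{7,m}(1)&=\binom m1+33\binom m2+178\binom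 m3+262\binom m4+131\binom m5+\binom m6,\\ c_{8,m}(1)&=\binom m1+68\binom m2+549\binom m3+1480\binom m4+1405\binom m5+428\binom m6+\binom m7. \end{align*} -/

import Mathlib

/-- Two words `v`, `w` over a linearly ordered alphabet such that `w` arises from `v` by one of the
two elementary Knuth moves: `x a c b y ↦ x c a b y` with `a ≤ b < c`, or
`x b a c y ↦ x b c a y` with `a < b ≤ c`. -/
inductive KnuthMove {α : Type*} [LinearOrder α] : List α → List α → Prop
  | left (x y : List α) (a b c : α) (hab : a ≤ b) (hbc : b < c) :
      KnuthMove (x ++ [a, c, b] ++ y) (x ++ [c, a, b] ++ y)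
  | right (x y : List α) (a b c : α) (hab : a < b) (hbc : b ≤ c) :
      KnuthMove (x ++ [b, a, c] ++ y) (x ++ [b, c, a] ++ y)

/-- Knuth equivalence of words: one word is obtained from the other by a finite sequence of Knuth
moves, each applied in either direction. -/
def KnuthEquiv {α : Type*} [LinearOrder α] : List α → List α → Prop :=
  Relation.EqvGen KnuthMove

/-- The set `C(u)` of all words `w` over the positive integers for which `uw` and `wu` are
Knuth equivalent. -/
def knuthCentralizer (u : List ℕ+) : Set (List ℕ+) :=
  {w | KnuthEquiv (u ++ w) (w ++ u)}

/-- The number `c_{n,m}(u)` of words in `C(u)` of length `n` all of whose letters are at most `m`. -/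
noncomputable def centralizerCount (n m : ℕ) (u : List ℕ+) : ℕ :=
  {w ∈ knuthCentralizer u | w.length = n ∧ ∀ a ∈ w, (a : ℕ) ≤ m}.ncard

/-! A word commutes with the letter 1 exactly when the first row of its insertion tableau consists
of 1s (`mem_knuthCentralizer_one`).

Necessity: the first row is a Knuth invariant (`KnuthEquiv.rowInsertWord_eq`). Let R be its part
without 1s. A 1 in front of the word puts one more 1 before R, while a 1 at the end also bumps the
first entry of R. Equality of the two rows gives R = R.tail, so R is empty.

Sufficiency: every word is equivalent to a product of strictly decreasing columns whose last letters
form the first row (`exists_knuthEquiv_columnWord`, `rowInsertWord_columnWord`). If all these last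
letters equal b, then b passes through each column in turn.

Counting: the words are sorted by their set of letters other than 1. Only the size j of this set
matters, so the count is the sum over j of binom(m-1, j) times the number `packedCount n j`, which
vanishes for j > n. The finitely many remaining numbers come from a recursion on the row R evaluated
by the kernel, and Pascal's rule passes from m-1 to m. -/

namespace KnuthEquiv

variable {α : Type*} [LinearOrder α]

theorem refl (w : List α) : KnuthEquiv w w := Relation.EqvGen.refl w

theorem symm {v w : List α} (h : KnuthEquiv v w) : KnuthEquiv w v := Relation.EqvGen.symm _ _ h

theorem trans {u v w : List α} (h : KnuthEquiv u v) (h' : KnuthEquiv v w) : KnuthEquiv u w :=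
  Relation.EqvGen.trans _ _ _ h h'

/-- Knuth equivalence is compatible with concatenation on both sides. -/
theorem context (p q : List α) {v w : List α} (h : KnuthEquiv v w) :
    KnuthEquiv (p ++ v ++ q) (p ++ w ++ q) := by
  induction h with
  | rel v w h =>
    refine Relation.EqvGen.rel _ _ ?_
    cases h with
    | left x y a b c hab hbc =>
      simpa using KnuthMove.left (p ++ x) (y ++ q) a b c hab hbc
    | right x y a b c hab hbc =>
      simpa using KnuthMove.right (p ++ x) (y ++ q) a b c hab hbc
  | refl w => exact refl _
  | symm v w _ ih => exact ih.symm
  | trans u v w _ _ ih ih' => exact ih.trans ih'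

theorem append_left (p : List α) {v w : List α} (h : KnuthEquiv v w) :
    KnuthEquiv (p ++ v) (p ++ w) := by
  simpa using h.context p []

theorem append_right (q : List α) {v w : List α} (h : KnuthEquiv v w) :
    KnuthEquiv (v ++ q) (w ++ q) := by
  simpa using h.context [] q

theorem cons (a : α) {v w : List α} (h : KnuthEquiv v w) : KnuthEquiv (a :: v) (a :: w) :=
  h.append_left [a]

theorem swap_left {a b c : α} (hab : a ≤ b) (hbc : b < c) (y : List α) :
    KnuthEquiv (a :: c :: b :: y) (c :: a :: b :: y) :=
  Relation.EqvGen.rel _ _ (KnuthMove.left [] y a b c hab hbc)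

theorem swap_right {a b c : α} (hab : a < b) (hbc : b ≤ c) (y : List α) :
    KnuthEquiv (b :: a :: c :: y) (b :: c :: a :: y) :=
  Relation.EqvGen.rel _ _ (KnuthMove.right [] y a b c hab hbc)

end KnuthEquiv

/-! ### The first row of the insertion tableau as a Knuth invariant. -/

section Row

variable {α : Type*} [LinearOrder α]

/-- Schensted insertion of a letter into a row; the bumped letter is forgotten. -/
def rowInsert (a : α) : List α → List α
  | [] => [a]
  | x :: R => if a < x then a :: R else x :: rowInsert a R

theorem mem_rowInsert {a e : α} {R : List α} (h : e ∈ rowInsert a R) : e = a ∨ e ∈ R := by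
  induction R with
  | nil => simpa [rowInsert] using h
  | cons x R ih =>
    simp only [rowInsert] at h
    split_ifs at h <;> simp only [List.mem_cons] at h ⊢ <;> tauto

theorem pairwise_rowInsert (a : α) {R : List α} (h : R.Pairwise (· ≤ ·)) :
    (rowInsert a R).Pairwise (· ≤ ·) := by
  induction R with
  | nil => simp [rowInsert]
  | cons x R ih =>
    rw [List.pairwise_cons] at h
    simp only [rowInsert]
    split_ifs with hax
    · exact List.pairwise_cons.2 ⟨fun e he => hax.le.trans (h.1 e he), h.2⟩
    · refine List.pairwise_cons.2 ⟨fun e he => ?_, ih h.2⟩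
      rcases mem_rowInsert he with rfl | he
      · exact not_lt.1 hax
      · exact h.1 e he

/-- The orders a, c and c, a give different rows only if both letters aim at the same position: then
c either survives just right of a or is bumped by a. The letter b lands just right of a in both
cases and erases the difference. Sortedness ensures that c lands next to a. -/
theorem rowInsert_swap_left {a b c : α} (hab : a ≤ b) (hbc : b < c) {R : List α}
    (h : R.Pairwise (· ≤ ·)) :
    rowInsert b (rowInsert c (rowInsert a R)) = rowInsert b (rowInsert a (rowInsert c R)) := by
  have hac := hab.trans_lt hbc
  induction R with
  | nil => simp [rowInsert, hac, hac.not_gt, hab.not_gt, hbc]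
  | cons x R ih =>
    rw [List.pairwise_cons] at h
    by_cases hax : a < x
    · by_cases hcx : c < x
      · cases R with
        | nil => simp [rowInsert, hax, hcx, hac, hac.not_gt, hab.not_gt, hbc]
        | cons y R =>
          have hcy : c < y := hcx.trans_le (h.1 y (by simp))
          simp [rowInsert, hax, hcx, hac, hac.not_gt, hab.not_gt, hbc, hcy, hbc.trans hcy]
      · simp [rowInsert, hax, hcx, hac.not_gt, hab.not_gt]
    · have hxb : ¬ b < x := fun hb => hax (hab.trans_lt hb)
      have hxc : ¬ c < x := fun hc => hax (hac.trans hc)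
      simp [rowInsert, hax, hxb, hxc, ih h.2]

/-- Once b sits in the row, a lands at or before its position and c strictly after it, so the two
insertions do not interact. -/
theorem rowInsert_swap_right {a b c : α} (hab : a < b) (hbc : b ≤ c) (R : List α) :
    rowInsert c (rowInsert a (rowInsert b R)) = rowInsert a (rowInsert c (rowInsert b R)) := by
  have hac := hab.trans_le hbc
  induction R with
  | nil => simp [rowInsert, hab, hac.not_gt, hbc.not_gt]
  | cons x R ih =>
    by_cases hax : a < x
    · by_cases hbx : b < x
      · simp [rowInsert, hbx, hab, hac.not_gt, hbc.not_gt]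
      · have hcx : ¬ c < x := fun h => hbx (hbc.trans_lt h)
        simp [rowInsert, hax, hbx, hcx, hac.not_gt]
    · have hbx : ¬ b < x := fun h => hax (hab.trans h)
      have hcx : ¬ c < x := fun h => hax (hac.trans h)
      simp [rowInsert, hax, hbx, hcx, ih]

/-- Insertion of all letters of a word, from left to right, into a row. -/
def rowInsertWord (R w : List α) : List α := w.foldl (fun R a => rowInsert a R) R

@[simp] theorem rowInsertWord_nil (R : List α) : rowInsertWord R [] = R := rfl

@[simp] theorem rowInsertWord_cons (R : List α) (a : α) (w : List α) :
    rowInsertWord R (a :: w) = rowInsertWord (rowInsert a R) w := rfl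

@[simp] theorem rowInsertWord_append (R v w : List α) :
    rowInsertWord R (v ++ w) = rowInsertWord (rowInsertWord R v) w := List.foldl_append

theorem pairwise_rowInsertWord (w : List α) {R : List α} (h : R.Pairwise (· ≤ ·)) :
    (rowInsertWord R w).Pairwise (· ≤ ·) := by
  induction w generalizing R with
  | nil => exact h
  | cons a w ih => exact ih (pairwise_rowInsert a h)

/-- The first row of the insertion tableau is an invariant of Knuth equivalence. -/
theorem KnuthEquiv.rowInsertWord_eq {v w : List α} (h : KnuthEquiv v w) :
    rowInsertWord [] v = rowInsertWord [] w := by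
  induction h with
  | rel v w h =>
    cases h with
    | left x y a b c hab hbc =>
      simp [rowInsert_swap_left hab hbc (pairwise_rowInsertWord x List.Pairwise.nil)]
    | right x y a b c hab hbc => simp [rowInsert_swap_right hab hbc]
  | refl w => rfl
  | symm v w _ ih => exact ih.symm
  | trans u v w _ _ ih ih' => exact ih.trans ih'

theorem rowInsert_eq_append {a : α} {R : List α} (h : ∀ e ∈ R, e ≤ a) :
    rowInsert a R = R ++ [a] := by
  induction R with
  | nil => rfl
  | cons x R ih =>
    simp only [List.mem_cons, forall_eq_or_imp] at h
    simp [rowInsert, h.1.not_gt, ih h.2]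

theorem rowInsert_append_singleton {a d : α} {R : List α} (h : ∀ e ∈ R, e ≤ a) (had : a < d) :
    rowInsert a (R ++ [d]) = R ++ [a] := by
  induction R with
  | nil => simp [rowInsert, had]
  | cons x R ih =>
    simp only [List.mem_cons, forall_eq_or_imp] at h
    simp [rowInsert, h.1.not_gt, ih h.2]

end Row

/-! ### Normal form of a word as a product of columns. -/

section Column

/-- The concatenation of a sequence of columns. -/
def columnWord {α : Type*} (L : List (List α × α)) : List α := L.flatMap fun p => p.1 ++ [p.2]

@[simp] theorem columnWord_nil {α : Type*} : columnWord ([] : List (List α × α)) = [] := rfl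

@[simp] theorem columnWord_cons {α : Type*} (p : List α × α) (L : List (List α × α)) :
    columnWord (p :: L) = p.1 ++ [p.2] ++ columnWord L := rfl

variable {α : Type*} [LinearOrder α]

/-- A nonempty strictly decreasing word `D b` with last letter `b` is recorded as `(D, b)`. -/
def IsColumn (p : List α × α) : Prop := (p.1 ++ [p.2]).Pairwise (· > ·)

/-- Sequences of columns whose last letters increase weakly. -/
def IsColumnSeq (L : List (List α × α)) : Prop :=
  (∀ p ∈ L, IsColumn p) ∧ L.Pairwise fun p q => p.2 ≤ q.2

theorem isColumnSeq_cons {p : List α × α} {L : List (List α × α)} :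
    IsColumnSeq (p :: L) ↔ IsColumn p ∧ (∀ q ∈ L, p.2 ≤ q.2) ∧ IsColumnSeq L := by
  simp only [IsColumnSeq, List.mem_cons, forall_eq_or_imp, List.pairwise_cons]
  tauto

theorem IsColumn.le_of_mem {p : List α × α} (h : IsColumn p) {e : α} (he : e ∈ p.1 ++ [p.2]) :
    p.2 ≤ e := by
  rw [IsColumn, List.pairwise_append] at h
  rcases List.mem_append.1 he with he | he
  · exact (h.2.2 e he p.2 (by simp)).le
  · simp_all

/-- Each letter of the column bumps its predecessor from the last cell of the row, so only b remains
there. -/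
theorem rowInsertWord_column_aux {b d : α} {D R : List α} (hR : ∀ e ∈ R, e ≤ b)
    (h : (d :: (D ++ [b])).Pairwise (· > ·)) :
    rowInsertWord (R ++ [d]) (D ++ [b]) = R ++ [b] := by
  induction D generalizing d with
  | nil =>
    have : b < d := by simpa using h
    simp [rowInsert_append_singleton hR this]
  | cons c D ih =>
    rw [List.pairwise_cons] at h
    have hcd : c < d := h.1 c (by simp)
    have hbc : b ≤ c := (((List.pairwise_cons.1 h.2).1 b (by simp)) : b < c).le
    rw [List.cons_append, rowInsertWord_cons,
      rowInsert_append_singleton (fun e he => (hR e he).trans hbc) hcd]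
    exact ih h.2

theorem rowInsertWord_column {p : List α × α} {R : List α} (hR : ∀ e ∈ R, e ≤ p.2)
    (h : IsColumn p) : rowInsertWord R (p.1 ++ [p.2]) = R ++ [p.2] := by
  obtain ⟨D, b⟩ := p
  cases D with
  | nil => exact rowInsert_eq_append hR
  | cons c D =>
    have hbc : b ≤ c := h.le_of_mem (by simp)
    rw [List.cons_append, rowInsertWord_cons, rowInsert_eq_append fun e he => (hR e he).trans hbc]
    exact rowInsertWord_column_aux hR h

/-- The first row of the insertion tableau of a column sequence consists of the last letters. -/
theorem rowInsertWord_columnWord {L : List (List α × α)} (hL : IsColumnSeq L) {R : List α}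
    (hR : ∀ e ∈ R, ∀ p ∈ L, e ≤ p.2) :
    rowInsertWord R (columnWord L) = R ++ L.map Prod.snd := by
  induction L generalizing R with
  | nil => simp
  | cons p L ih =>
    rw [isColumnSeq_cons] at hL
    rw [columnWord_cons, rowInsertWord_append,
      rowInsertWord_column (fun e he => hR e he p (by simp)) hL.1, ih hL.2.2]
    · simp
    · intro e he q hq
      rcases List.mem_append.1 he with he | he
      · exact hR e he q (by simp [hq])
      · rw [List.mem_singleton.1 he]
        exact hL.2.1 q hq

/-- The letter c travels to the right: x c d becomes x d c because d < x ≤ c, and d then takes the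
role of x. -/
theorem knuthEquiv_move_through {x c : α} {D : List α} (h : (x :: D).Pairwise (· > ·))
    (hxc : x ≤ c) : KnuthEquiv (x :: c :: D) (x :: (D ++ [c])) := by
  induction D generalizing x with
  | nil => exact KnuthEquiv.refl _
  | cons d D ih =>
    rw [List.pairwise_cons] at h
    have hdx : d < x := h.1 d (by simp)
    exact (KnuthEquiv.swap_right hdx hxc D).symm.trans ((ih h.2 (hdx.le.trans hxc)).cons x)

/-- Column insertion of a letter that bumps another letter out of the column. -/
theorem exists_column_bump {x b : α} {D : List α} (h : IsColumn (D, b))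
    (hx : ∃ e ∈ D ++ [b], x ≤ e) :
    ∃ D' b' y, KnuthEquiv (x :: (D ++ [b])) (D' ++ [b'] ++ [y]) ∧ IsColumn (D', b') ∧
      (∀ e ∈ D' ++ [b'], e = x ∨ e ∈ D ++ [b]) ∧ b' ≤ y ∧ b' ≤ b := by
  induction D with
  | nil =>
    have hxb : x ≤ b := by simpa using hx
    exact ⟨[], x, b, KnuthEquiv.refl _, by simp [IsColumn], by simp, hxb, hxb⟩
  | cons c D ih =>
    have hc : ∀ e ∈ D ++ [b], e < c := (List.pairwise_cons.1 h).1
    have hD : IsColumn (D, b) := (List.pairwise_cons.1 h).2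
    -- The letter x bumps the smallest entry ≥ x. If that entry lies below c, then x first passes c
    -- by a move x c d → c x d with x ≤ d < c; otherwise c itself is bumped.
    by_cases hx' : ∃ e ∈ D ++ [b], x ≤ e
    · obtain ⟨D', b', y, h1, h2, h3, h4, h5⟩ := ih hD hx'
      obtain ⟨e, he, hxe⟩ := hx'
      have hxc : x < c := hxe.trans_lt (hc e he)
      refine ⟨c :: D', b', y, ?_, ?_, ?_, h4, h5⟩
      · refine KnuthEquiv.trans ?_ (h1.cons c)
        obtain ⟨d, E, hE⟩ : ∃ d E, D ++ [b] = d :: E := List.exists_cons_of_ne_nil (by simp)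
        have hd : d < c := hc d (by simp [hE])
        have hxd : x ≤ d := by
          have hD' := hD
          rw [IsColumn, hE, List.pairwise_cons] at hD'
          rw [hE, List.mem_cons] at he
          rcases he with rfl | he
          · exact hxe
          · exact hxe.trans (hD'.1 e he).le
        rw [List.cons_append, hE]
        exact KnuthEquiv.swap_left hxd hd E
      · refine List.pairwise_cons.2 ⟨fun e he => ?_, h2⟩
        rcases h3 e he with rfl | he
        · exact hxc
        · exact hc e he
      · intro e he
        rw [List.cons_append, List.mem_cons] at he ⊢
        rcases he with he | he
        · exact Or.inr (Or.inl he)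
        · exact (h3 e he).imp_right Or.inr
    · push Not at hx'
      have hxc : x ≤ c := by
        obtain ⟨e, he, hxe⟩ := hx
        rcases List.mem_cons.1 he with rfl | he
        · exact hxe
        · exact absurd hxe (hx' e he).not_ge
      have hcol : (x :: (D ++ [b])).Pairwise (· > ·) := List.pairwise_cons.2 ⟨hx', hD⟩
      refine ⟨x :: D, b, c, ?_, hcol, ?_, (hc b (by simp)).le, le_rfl⟩
      · exact knuthEquiv_move_through hcol hxc
      · intro e he
        rw [List.cons_append, List.mem_cons] at he ⊢
        tauto

/-- The bumped letter is inserted into the next column, and so on. The clause on lower bounds z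
carries the induction: with z the last letter of the new first column, it keeps the last letters
weakly increasing. -/
theorem exists_isColumnSeq_cons (x : α) {L : List (List α × α)} (hL : IsColumnSeq L) :
    ∃ L', IsColumnSeq L' ∧ KnuthEquiv (x :: columnWord L) (columnWord L') ∧
      ∀ z ≤ x, (∀ p ∈ L, z ≤ p.2) → ∀ p ∈ L', z ≤ p.2 := by
  induction L generalizing x with
  | nil =>
    exact ⟨[([], x)], by simp [IsColumnSeq, IsColumn], KnuthEquiv.refl _, by simp⟩
  | cons p L ih =>
    obtain ⟨hp, hpL, hT⟩ := isColumnSeq_cons.1 hL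
    obtain ⟨D, b⟩ := p
    by_cases hx : ∃ e ∈ D ++ [b], x ≤ e
    · obtain ⟨D', b', y, h1, h2, h3, h4, h5⟩ := exists_column_bump hp hx
      obtain ⟨L', hL', hyL, hz⟩ := ih y hT
      refine ⟨(D', b') :: L', isColumnSeq_cons.2 ⟨h2, ?_, hL'⟩, ?_, ?_⟩
      · exact hz b' h4 fun q hq => h5.trans (hpL q hq)
      · have h6 := (h1.append_right (columnWord L)).trans
          (by simpa using hyL.append_left (D' ++ [b']))
        simpa using h6
      · intro z hzx hzL
        have hzb' : z ≤ b' := by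
          rcases h3 b' (by simp) with h | h
          · exact h ▸ hzx
          · exact (hzL _ (by simp)).trans (hp.le_of_mem h)
        simp only [List.mem_cons, forall_eq_or_imp] at hzL ⊢
        exact ⟨hzb', hz z (hzb'.trans h4) hzL.2⟩
    · push Not at hx
      refine ⟨(x :: D, b) :: L, isColumnSeq_cons.2 ⟨List.pairwise_cons.2 ⟨hx, hp⟩, hpL, hT⟩,
        KnuthEquiv.refl _, ?_⟩
      intro z hzx hzL
      simpa using hzL

/-- Every word is Knuth equivalent to a product of columns with weakly increasing last letters. -/
theorem exists_knuthEquiv_columnWord (w : List α) :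
    ∃ L, IsColumnSeq L ∧ KnuthEquiv w (columnWord L) := by
  induction w with
  | nil => exact ⟨[], by simp [IsColumnSeq], KnuthEquiv.refl _⟩
  | cons x w ih =>
    obtain ⟨L, hL, h⟩ := ih
    obtain ⟨L', hL', h', -⟩ := exists_isColumnSeq_cons x hL
    exact ⟨L', hL', (h.cons x).trans h'⟩

/-- Since b is the least letter of the column, b c d → c b d with b ≤ d < c moves it down step by
step until it meets the final b. -/
theorem knuthEquiv_column_comm {b : α} {D : List α} (h : IsColumn (D, b)) :
    KnuthEquiv (b :: (D ++ [b])) (D ++ [b] ++ [b]) := by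
  induction D with
  | nil => exact KnuthEquiv.refl _
  | cons c D ih =>
    have hc : ∀ e ∈ D ++ [b], e < c := (List.pairwise_cons.1 h).1
    have hD : IsColumn (D, b) := (List.pairwise_cons.1 h).2
    refine KnuthEquiv.trans ?_ ((ih hD).cons c)
    obtain ⟨d, E, hE⟩ : ∃ d E, D ++ [b] = d :: E := List.exists_cons_of_ne_nil (by simp)
    have hd : d ∈ D ++ [b] := by simp [hE]
    rw [List.cons_append, hE]
    exact KnuthEquiv.swap_left (hD.le_of_mem hd) (hc d hd) E

theorem knuthEquiv_columnWord_comm {b : α} {L : List (List α × α)} (h : IsColumnSeq L)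
    (hb : ∀ p ∈ L, p.2 = b) : KnuthEquiv (b :: columnWord L) (columnWord L ++ [b]) := by
  induction L with
  | nil => exact KnuthEquiv.refl _
  | cons p L ih =>
    obtain ⟨hp, -, hL⟩ := isColumnSeq_cons.1 h
    obtain ⟨D, c⟩ := p
    simp only [List.mem_cons, forall_eq_or_imp] at hb
    obtain ⟨rfl, hb⟩ := hb
    have h1 := (knuthEquiv_column_comm hp).append_right (columnWord L)
    have h2 := (ih hL hb).append_left (D ++ [c])
    simp only [columnWord_cons, List.append_assoc, List.cons_append, List.nil_append] at h1 h2 ⊢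
    exact h1.trans h2

theorem knuthEquiv_comm_of_rowInsertWord {b : α} {w : List α}
    (h : ∀ e ∈ rowInsertWord [] w, e = b) : KnuthEquiv (b :: w) (w ++ [b]) := by
  obtain ⟨L, hL, hw⟩ := exists_knuthEquiv_columnWord w
  rw [hw.rowInsertWord_eq, rowInsertWord_columnWord hL (by simp)] at h
  have hb : ∀ p ∈ L, p.2 = b := fun p hp => h _ (by simpa using ⟨p.1, hp⟩)
  exact ((hw.cons b).trans (knuthEquiv_columnWord_comm hL hb)).trans (hw.symm.append_right [b])

end Column

/-! ### The centralizer of the letter 1 and its enumeration. -/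

section Centralizer

/-- The effect of appending the letter `a` to a word on the letters different from `1` in the
first row of its insertion tableau. -/
def reducedInsert (a : ℕ+) (R : List ℕ+) : List ℕ+ := if a = 1 then R.tail else rowInsert a R

/-- The letters different from `1` in the first row obtained by inserting `w` into `R`. -/
def reducedRow (R w : List ℕ+) : List ℕ+ := w.foldl (fun R a => reducedInsert a R) R

@[simp] theorem reducedRow_nil (R : List ℕ+) : reducedRow R [] = R := rfl

@[simp] theorem reducedRow_cons (R : List ℕ+) (a : ℕ+) (w : List ℕ+) :
    reducedRow R (a :: w) = reducedRow (reducedInsert a R) w := rfl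

theorem one_notMem_reducedInsert {a : ℕ+} {R : List ℕ+} (hR : 1 ∉ R) :
    1 ∉ reducedInsert a R := by
  unfold reducedInsert
  split_ifs with ha
  · exact fun h => hR (List.mem_of_mem_tail h)
  · intro h
    rcases mem_rowInsert h with h | h
    · exact ha h.symm
    · exact hR h

theorem one_notMem_reducedRow (w : List ℕ+) {R : List ℕ+} (hR : 1 ∉ R) :
    1 ∉ reducedRow R w := by
  induction w generalizing R with
  | nil => exact hR
  | cons a w ih => exact ih (one_notMem_reducedInsert hR)

theorem rowInsert_one {R : List ℕ+} (hR : 1 ∉ R) : rowInsert 1 R = 1 :: R.tail := by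
  cases R with
  | nil => rfl
  | cons x R =>
    have hx : (1 : ℕ+) < x := lt_of_le_of_ne one_le fun h => hR (by simp [h])
    simp [rowInsert, hx]

theorem rowInsert_replicate_one (k : ℕ) (a : ℕ+) (R : List ℕ+) :
    rowInsert a (List.replicate k 1 ++ R) = List.replicate k 1 ++ rowInsert a R := by
  induction k with
  | zero => rfl
  | succ k ih => simp [List.replicate_succ, rowInsert, ih]

/-- The initial 1s are never bumped, and a new 1 replaces the first larger entry. Hence the rest of
the row evolves independently of the number of 1s. -/
theorem rowInsertWord_replicate_one (w : List ℕ+) (k : ℕ) {R : List ℕ+} (hR : 1 ∉ R) :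
    rowInsertWord (List.replicate k 1 ++ R) w =
      List.replicate (k + w.count 1) 1 ++ reducedRow R w := by
  induction w generalizing k R with
  | nil => simp
  | cons a w ih =>
    rw [rowInsertWord_cons, reducedRow_cons, rowInsert_replicate_one]
    by_cases ha : a = 1
    · subst ha
      have h : List.replicate k (1 : ℕ+) ++ rowInsert 1 R =
          List.replicate (k + 1) 1 ++ reducedInsert 1 R := by
        simp [rowInsert_one hR, reducedInsert, List.replicate_succ']
      rw [h, ih _ (one_notMem_reducedInsert hR), List.count_cons_self, add_right_comm, add_assoc]
    · have h : rowInsert a R = reducedInsert a R := by simp [reducedInsert, ha]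
      rw [h, ih _ (one_notMem_reducedInsert hR), List.count_cons_of_ne ha]

/-- A word commutes with the letter `1` up to Knuth equivalence if and only if the first row of
its insertion tableau has no letter different from `1`. -/
theorem mem_knuthCentralizer_one {w : List ℕ+} :
    w ∈ knuthCentralizer [1] ↔ reducedRow [] w = [] := by
  have hrow : ∀ k, rowInsertWord (List.replicate k 1) w =
      List.replicate (k + w.count 1) 1 ++ reducedRow [] w := fun k => by
    simpa using rowInsertWord_replicate_one w k (R := []) (by simp)
  have hnil : rowInsertWord [] w = List.replicate (w.count 1) 1 ++ reducedRow [] w := by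
    simpa using hrow 0
  constructor
  · intro h
    have h1 : rowInsertWord [] ([1] ++ w) =
        List.replicate (1 + w.count 1) 1 ++ reducedRow [] w := hrow 1
    have h2 : rowInsertWord [] (w ++ [1]) =
        List.replicate (1 + w.count 1) 1 ++ (reducedRow [] w).tail := by
      rw [rowInsertWord_append, hnil, rowInsertWord_cons, rowInsertWord_nil,
        rowInsert_replicate_one, rowInsert_one (one_notMem_reducedRow w (by simp)), add_comm 1,
        List.replicate_succ', List.append_assoc, List.singleton_append]
    have h3 := KnuthEquiv.rowInsertWord_eq h
    rw [h1, h2] at h3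
    -- A list with the same length as its tail is empty.
    have h4 := congrArg List.length (List.append_cancel_left h3)
    rw [List.length_tail] at h4
    exact List.length_eq_zero_iff.1 (by omega)
  · intro h
    refine knuthEquiv_comm_of_rowInsertWord fun e he => ?_
    rw [show rowInsertWord [] ([].append w) = rowInsertWord [] w from rfl, hnil, h,
      List.append_nil] at he
    exact List.eq_of_mem_replicate he

/-- The words of length `n` in the letter `1` and the letters of `S`, containing every letter of
`T`, that reduce the row `R` to the empty row. -/
def reducingWords (S : List ℕ+) : ℕ → List ℕ+ → List ℕ+ → List (List ℕ+)
  | 0, T, R => if T = [] ∧ R = [] then [[]] else []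
  | n + 1, T, R => (reducingWords S n T R.tail).map (1 :: ·) ++
      S.flatMap fun a => (reducingWords S n (T.filter (· ≠ a)) (rowInsert a R)).map (a :: ·)

theorem mem_reducingWords {S : List ℕ+} (hS : 1 ∉ S) {n : ℕ} {T R w : List ℕ+} (hT : 1 ∉ T) :
    w ∈ reducingWords S n T R ↔ w.length = n ∧ (∀ a ∈ w, a = 1 ∨ a ∈ S) ∧ (∀ t ∈ T, t ∈ w) ∧
      reducedRow R w = [] := by
  induction n generalizing T R w with
  | zero =>
    cases w with
    | nil =>
      simp only [reducingWords]
      split_ifs with h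
      · simp [h]
      · simp only [List.not_mem_nil, imp_false, false_iff]
        rintro ⟨-, -, h1, h2⟩
        exact h ⟨List.eq_nil_iff_forall_not_mem.2 h1, h2⟩
    | cons a w => simp only [reducingWords]; split_ifs <;> simp
  | succ n ih =>
    cases w with
    | nil => simp [reducingWords]
    | cons b w =>
      have h1 : b :: w ∈ reducingWords S (n + 1) T R ↔
          (b = 1 ∧ w ∈ reducingWords S n T R.tail) ∨
          (b ∈ S ∧ w ∈ reducingWords S n (T.filter (· ≠ b)) (rowInsert b R)) := by
        simp only [reducingWords, List.mem_append, List.mem_map, List.mem_flatMap, List.cons.injEq]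
        constructor
        · rintro (⟨_, h, rfl, rfl⟩ | ⟨_, h, _, h', rfl, rfl⟩)
          · exact Or.inl ⟨rfl, h⟩
          · exact Or.inr ⟨h, h'⟩
        · rintro (⟨rfl, h⟩ | ⟨h, h'⟩)
          · exact Or.inl ⟨_, h, rfl, rfl⟩
          · exact Or.inr ⟨b, h, w, h', rfl, rfl⟩
      rw [h1, ih hT, ih (fun h => hT (List.mem_of_mem_filter h))]
      by_cases hb : b = 1
      · subst hb
        have h2 : (∀ t ∈ T, t ∈ (1 : ℕ+) :: w) ↔ ∀ t ∈ T, t ∈ w := by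
          refine forall₂_congr fun t ht => ?_
          rw [List.mem_cons, or_iff_right]
          rintro rfl
          exact hT ht
        rw [h2]
        simp [hS, reducedInsert]
      · have h2 : (∀ t ∈ T, t ∈ b :: w) ↔ ∀ t ∈ T.filter (· ≠ b), t ∈ w := by
          simp only [List.mem_cons, List.mem_filter, decide_eq_true_eq, and_imp]
          exact forall₂_congr fun t _ => or_iff_not_imp_left
        rw [h2]
        simp only [hb, reducedInsert, false_and, false_or, List.length_cons, add_left_inj,
          List.mem_cons, forall_eq_or_imp, if_false, reducedRow_cons]
        tauto

theorem nodup_reducingWords {S : List ℕ+} (hS : 1 ∉ S) (hS' : S.Nodup) (n : ℕ) (T R : List ℕ+) :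
    (reducingWords S n T R).Nodup := by
  induction n generalizing T R with
  | zero => simp only [reducingWords]; split_ifs <;> simp
  | succ n ih =>
    have hinj : ∀ a : ℕ+, Function.Injective (a :: · : List ℕ+ → List ℕ+) :=
      fun a => List.cons_injective
    rw [reducingWords, List.nodup_append', List.nodup_flatMap]
    refine ⟨(ih _ _).map (hinj 1), ⟨fun a _ => (ih _ _).map (hinj a), ?_⟩, ?_⟩
    · refine hS'.imp fun {a b} hab => ?_
      intro w hw hw'
      obtain ⟨v, -, rfl⟩ := List.mem_map.1 hw
      obtain ⟨v', -, h⟩ := List.mem_map.1 hw'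
      exact hab (List.cons.inj h).1.symm
    · intro w hw hw'
      obtain ⟨v, -, rfl⟩ := List.mem_map.1 hw
      obtain ⟨a, ha, hw'⟩ := List.mem_flatMap.1 hw'
      obtain ⟨v', -, h⟩ := List.mem_map.1 hw'
      exact hS ((List.cons.inj h).1 ▸ ha)

end Centralizer

/-! ### Reduction to packed words. -/

section Count

variable {α β : Type*} [LinearOrder α] [LinearOrder β]

/-- The number of words of length `n` in a least letter and the letters of `S`, containing every
letter of `T`, that reduce the row `R` to the empty row. -/
def reducingCount (S : List α) : ℕ → List α → List α → ℕ
  | 0, T, R => if T = [] ∧ R = [] then 1 else 0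
  | n + 1, T, R => reducingCount S n T R.tail +
      (S.map fun a => reducingCount S n (T.filter (· ≠ a)) (rowInsert a R)).sum

theorem length_reducingWords (S : List ℕ+) (n : ℕ) (T R : List ℕ+) :
    (reducingWords S n T R).length = reducingCount S n T R := by
  induction n generalizing T R with
  | zero => simp only [reducingWords, reducingCount]; split_ifs <;> rfl
  | succ n ih => simp [reducingWords, reducingCount, List.length_flatMap, ih]

theorem rowInsert_map {f : α → β} (hf : StrictMono f) (a : α) (R : List α) :
    rowInsert (f a) (R.map f) = (rowInsert a R).map f := by
  induction R with
  | nil => rfl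
  | cons x R ih =>
    simp only [rowInsert, List.map_cons, hf.lt_iff_lt, ih]
    split_ifs <;> rfl

/-- Insertion only compares letters, so the count depends only on the order type of the alphabet. -/
theorem reducingCount_map {f : α → β} (hf : StrictMono f) (S : List α) (n : ℕ) (T R : List α) :
    reducingCount (S.map f) n (T.map f) (R.map f) = reducingCount S n T R := by
  induction n generalizing T R with
  | zero => simp [reducingCount]
  | succ n ih =>
    have hfilter : ∀ a, (T.map f).filter (· ≠ f a) = (T.filter (· ≠ a)).map f := fun a => by
      rw [List.filter_map]
      congr 1
      refine List.filter_congr fun t _ => ?_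
      simp [hf.injective.eq_iff]
    simp only [reducingCount, List.map_map, ← List.map_tail, ih]
    congr 3
    funext a
    rw [Function.comp_apply, hfilter, rowInsert_map hf, ih]

theorem length_rowInsert_ge (a : α) (R : List α) : R.length ≤ (rowInsert a R).length := by
  induction R with
  | nil => simp
  | cons x R ih =>
    simp only [rowInsert]
    split_ifs <;> simp [ih]

/-- Each letter lowers the total length of `T` and `R` by at most one: the least letter can only
shorten `R`, any other letter can only shorten `T`. This bound also prunes the computation. -/
theorem reducingCount_eq_zero (S : List α) {n : ℕ} {T R : List α} (hT : T.Nodup)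
    (h : n < T.length + R.length) : reducingCount S n T R = 0 := by
  induction n generalizing T R with
  | zero =>
    rw [reducingCount, if_neg]
    rintro ⟨rfl, rfl⟩
    simp at h
  | succ n ih =>
    rw [reducingCount, Nat.add_eq_zero_iff]
    constructor
    · apply ih hT
      rw [List.length_tail]
      omega
    · refine List.sum_eq_zero fun c hc => ?_
      obtain ⟨a, -, rfl⟩ := List.mem_map.1 hc
      apply ih (hT.filter _)
      have h1 : T.length - 1 ≤ (T.filter (· ≠ a)).length := by
        have h2 : T.filter (· ≠ a) = T.erase a := by
          rw [hT.erase_eq_filter]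
          exact List.filter_congr fun t _ => by simp [bne, Bool.beq_eq_decide_eq]
        rw [h2, List.length_erase]
        split_ifs <;> omega
      have h3 := length_rowInsert_ge a R
      omega

/-- The number of words of length `n` in `k + 1` letters, all of which except possibly the least
one occur, that commute with the least letter up to Knuth equivalence. -/
def packedCount (n k : ℕ) : ℕ := reducingCount (List.range k) n (List.range k) []

theorem packedCount_eq_zero {n k : ℕ} (h : n < k) : packedCount n k = 0 :=
  reducingCount_eq_zero _ List.nodup_range (by simpa using h)

/-- Both alphabets are strictly monotone images of `Fin S.card`. -/
theorem reducingCount_sort (S : Finset α) (n : ℕ) :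
    reducingCount S.sort n S.sort [] = packedCount n S.card := by
  have h2 : List.range S.card = (List.finRange S.card).map Fin.val := by simp
  have h3 := reducingCount_map (S.orderEmbOfFin rfl).strictMono (List.finRange S.card) n
    (List.finRange S.card) []
  have h4 := reducingCount_map (Fin.val_strictMono (n := S.card)) (List.finRange S.card) n
    (List.finRange S.card) []
  rw [Finset.listMap_orderEmbOfFin_finRange] at h3
  rw [packedCount, h2]
  exact h3.trans h4.symm

theorem centralizerCount_one_eq_sum (n k : ℕ) :
    centralizerCount n (k + 1) [1] = ∑ j ∈ Finset.range (k + 1), k.choose j * packedCount n j := by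
  set I : Finset ℕ+ := Finset.Icc 2 k.succPNat with hI
  have hIcard : I.card = k := by rw [hI, PNat.card_Icc]; simp
  have hone : (1 : ℕ+) ∉ I := by simp [hI]
  -- `W S` collects the words whose set of letters other than 1 is exactly `S`; these classes
  -- partition the set to be counted.
  set W : Finset ℕ+ → Finset (List ℕ+) :=
    fun S => (reducingWords S.sort n S.sort []).toFinset with hW
  have hmem : ∀ S ∈ I.powerset, ∀ w, w ∈ W S ↔ w.length = n ∧ reducedRow [] w = [] ∧
      S = w.toFinset.erase 1 := by
    intro S hS w
    have h1 : 1 ∉ S := fun h => hone (Finset.mem_powerset.1 hS h)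
    have h1' : 1 ∉ S.sort := by simpa using h1
    rw [hW, List.mem_toFinset, mem_reducingWords h1' h1']
    simp only [Finset.mem_sort, Finset.ext_iff, Finset.mem_erase, List.mem_toFinset]
    constructor
    · rintro ⟨h2, h3, h4, h5⟩
      refine ⟨h2, h5, fun a => ⟨fun h => ⟨?_, h4 a h⟩, fun h => (h3 a h.2).resolve_left h.1⟩⟩
      rintro rfl
      exact h1 h
    · rintro ⟨h2, h5, h3⟩
      exact ⟨h2, fun a ha => or_iff_not_imp_left.2 fun h => (h3 a).2 ⟨h, ha⟩,
        fun a ha => ((h3 a).1 ha).2, h5⟩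
  have hset : {w ∈ knuthCentralizer [1] | w.length = n ∧ ∀ a ∈ w, (a : ℕ) ≤ k + 1} =
      (I.powerset.biUnion W : Set (List ℕ+)) := by
    ext w
    rw [Set.mem_ofPred_eq, mem_knuthCentralizer_one, Finset.mem_coe, Finset.mem_biUnion]
    constructor
    · rintro ⟨h1, h2, h3⟩
      have h4 : w.toFinset.erase 1 ∈ I.powerset := by
        rw [Finset.mem_powerset]
        intro a ha
        rw [Finset.mem_erase, List.mem_toFinset] at ha
        rw [hI, Finset.mem_Icc]
        refine ⟨?_, PNat.coe_le_coe _ _ |>.1 (by simpa using h3 a ha.2)⟩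
        have h5 : (1 : ℕ+) < a := lt_of_le_of_ne one_le (Ne.symm ha.1)
        exact PNat.add_one_le_iff.2 h5
      exact ⟨_, h4, (hmem _ h4 w).2 ⟨h2, h1, rfl⟩⟩
    · rintro ⟨S, hS, hw⟩
      obtain ⟨h1, h2, rfl⟩ := (hmem S hS w).1 hw
      refine ⟨h2, h1, fun a ha => ?_⟩
      by_cases h : a = 1
      · simp [h]
      · have h3 := Finset.mem_powerset.1 hS (Finset.mem_erase.2 ⟨h, List.mem_toFinset.2 ha⟩)
        rw [hI, Finset.mem_Icc] at h3
        simpa using (PNat.coe_le_coe _ _).2 h3.2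
  have hcard : ∀ S ∈ I.powerset, (W S).card = packedCount n S.card := by
    intro S hS
    have h1 : 1 ∉ S.sort := by simpa using fun h => hone (Finset.mem_powerset.1 hS h)
    rw [hW, List.toFinset_card_of_nodup (nodup_reducingWords h1 (S.sort_nodup _) n _ _),
      length_reducingWords, reducingCount_sort]
  rw [centralizerCount, hset, Set.ncard_coe_finset, Finset.card_biUnion, Finset.sum_congr rfl hcard,
    Finset.sum_powerset_apply_card (packedCount n), hIcard]
  · rfl
  · intro S hS S' hS' hne
    rw [Function.onFun, Finset.disjoint_left]
    intro w hw hw'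
    exact hne (((hmem S hS w).1 hw).2.2.trans ((hmem S' hS' w).1 hw').2.2.symm)

/-- Only alphabets of at most `n + 1` letters contribute to the count. -/
theorem centralizerCount_one_eq_sum_range {n k : ℕ} (h : n ≤ k + 1) :
    centralizerCount n (k + 1) [1] = ∑ j ∈ Finset.range (n + 1), k.choose j * packedCount n j := by
  have h1 : centralizerCount n (k + 1) [1] =
      ∑ j ∈ Finset.range (k + 2), k.choose j * packedCount n j := by
    -- The zero term j = k + 1 is added because n may equal k + 1.
    rw [Finset.sum_range_succ, Nat.choose_succ_self, zero_mul, add_zero,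
      centralizerCount_one_eq_sum]
  rw [h1]
  symm
  refine Finset.sum_subset (fun j => by simp only [Finset.mem_range]; omega) fun j _ hj => ?_
  rw [packedCount_eq_zero (by simpa using hj), mul_zero]

end Count

/-! ### A form of the recursion that the kernel evaluates efficiently. -/

section Evaluation

/-- `rowInsert` for natural numbers, in a form suitable for evaluation. -/
def natRowInsert (a : ℕ) (R : List ℕ) : List ℕ :=
  R.rec [a] fun x R ih => bif Nat.blt a x then a :: R else x :: ih

/-- `reducingCount` at length `n + 1` for natural numbers, in a form suitable for evaluation. -/
def natReducingCount (S : List ℕ) (n : ℕ) : List ℕ → List ℕ → ℕ :=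
  -- Index 0 means length 1: the only letter must be the least one, which works exactly if `T` is
  -- empty and `R` has at most one entry.
  n.rec (fun T R => T.rec (R.rec 1 fun _ R _ => R.rec 1 fun _ _ _ => 0) fun _ _ _ => 0)
    fun n ih T R => bif Nat.ble (T.length + R.length) n.succ.succ then
        S.foldr (fun a s => ih (T.filter fun t => !(Nat.beq t a)) (natRowInsert a R) + s)
          (ih T R.tail)
      else 0

theorem natRowInsert_eq (a : ℕ) (R : List ℕ) : natRowInsert a R = rowInsert a R := by
  induction R with
  | nil => rfl
  | cons x R ih =>
    have h : natRowInsert a (x :: R) = bif Nat.blt a x then a :: R else x :: natRowInsert a R := rfl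
    rw [h, ih, rowInsert]
    by_cases hax : a < x
    · rw [if_pos hax, Eq.mpr Nat.blt_eq hax, cond_true]
    · rw [if_neg hax, Bool.eq_false_iff.2 (mt (Eq.mp Nat.blt_eq) hax), cond_false]

/-- A row is never empty after an insertion, so the last letter of a counted word is the least one.
-/
theorem reducingCount_zero_rowInsert {α : Type*} [LinearOrder α] (S T R : List α) (a : α) :
    reducingCount S 0 T (rowInsert a R) = 0 := by
  rw [reducingCount, if_neg]
  rintro ⟨-, h⟩
  cases R with
  | nil => simp [rowInsert] at h
  | cons x R => simp only [rowInsert] at h; split_ifs at h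

theorem foldr_add_eq {α : Type*} (f : α → ℕ) (c : ℕ) (l : List α) :
    l.foldr (fun a s => f a + s) c = c + (l.map f).sum := by
  induction l with
  | nil => simp
  | cons a l ih => rw [List.foldr_cons, ih, List.map_cons, List.sum_cons, add_left_comm]

theorem natReducingCount_eq (S : List ℕ) (n : ℕ) {T R : List ℕ} (hT : T.Nodup) :
    natReducingCount S n T R = reducingCount S (n + 1) T R := by
  induction n generalizing T R with
  | zero =>
    rw [reducingCount, List.sum_eq_zero (by simp [reducingCount_zero_rowInsert]), add_zero]
    cases T with
    | nil =>
      match R with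
      | [] => rfl
      | [_] => rfl
      | _ :: _ :: _ => rfl
    | cons t T => rfl
  | succ n ih =>
    have h : natReducingCount S (n + 1) T R = bif Nat.ble (T.length + R.length) (n + 2) then
        S.foldr (fun a s => natReducingCount S n (T.filter fun t => !(Nat.beq t a))
          (natRowInsert a R) + s) (natReducingCount S n T R.tail)
      else 0 := rfl
    rw [h]
    by_cases hle : T.length + R.length ≤ n + 2
    · rw [Eq.mpr Nat.ble_eq hle, cond_true, ih hT]
      have hstep : ∀ a, natReducingCount S n (T.filter fun t => !(Nat.beq t a)) (natRowInsert a R) =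
          reducingCount S (n + 1) (T.filter (· ≠ a)) (rowInsert a R) := fun a => by
        have h' : (T.filter fun t => !(Nat.beq t a)) = T.filter (· ≠ a) :=
          List.filter_congr fun t _ => by
            rw [Bool.eq_iff_iff, Bool.not_eq_true', Bool.eq_false_iff, Ne, Nat.beq_eq,
              decide_eq_true_eq]
        rw [ih (hT.filter _), natRowInsert_eq, h']
      simp only [hstep]
      exact foldr_add_eq _ _ S
    · rw [Bool.eq_false_iff.2 (mt (Eq.mp Nat.ble_eq) hle), cond_false,
        reducingCount_eq_zero S hT (by omega)]

/-- `packedCount` at length `n + 1`, in a form suitable for evaluation. -/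
def natPackedCount (n k : ℕ) : ℕ := natReducingCount (List.range k) n (List.range k) []

theorem packedCount_succ (n k : ℕ) : packedCount (n + 1) k = natPackedCount n k :=
  (natReducingCount_eq _ n List.nodup_range).symm

end Evaluation

/-! ### Numerical values and the final formulas. -/

section Values

set_option maxRecDepth 100000 in
/-- The numbers of packed words of length at most `8` in the centralizer of the letter `1`. -/
theorem natPackedCount_values :
    (List.range 2).map (natPackedCount 0) = [1, 0] ∧
    (List.range 3).map (natPackedCount 1) = [1, 1, 0] ∧
    (List.range 4).map (natPackedCount 2) = [1, 2, 1, 0] ∧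
    (List.range 5).map (natPackedCount 3) = [1, 5, 5, 1, 0] ∧
    (List.range 6).map (natPackedCount 4) = [1, 9, 21, 14, 1, 0] ∧
    (List.range 7).map (natPackedCount 5) = [1, 19, 66, 89, 42, 1, 0] ∧
    (List.range 8).map (natPackedCount 6) = [1, 34, 211, 440, 393, 132, 1, 0] ∧
    (List.range 9).map (natPackedCount 7) = [1, 69, 617, 2029, 2885, 1833, 429, 1, 0] := by
  decide +kernel

end Values

theorem mainTheorem12 :
    (∀ m : ℕ, 1 ≤ m → centralizerCount 1 m [1] = 1) ∧
    (∀ m : ℕ, 2 ≤ m → centralizerCount 2 m [1] = m.choose 1) ∧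
    (∀ m : ℕ, 3 ≤ m → centralizerCount 3 m [1] = m.choose 1 + m.choose 2) ∧
    (∀ m : ℕ, 4 ≤ m → centralizerCount 4 m [1] =
      m.choose 1 + 4 * m.choose 2 + m.choose 3) ∧
    (∀ m : ℕ, 5 ≤ m → centralizerCount 5 m [1] =
      m.choose 1 + 8 * m.choose 2 + 13 * m.choose 3 + m.choose 4) ∧
    (∀ m : ℕ, 6 ≤ m → centralizerCount 6 m [1] =
      m.choose 1 + 18 * m.choose 2 + 48 * m.choose 3 + 41 * m.choose 4 + m.choose 5) ∧
    (∀ m : ℕ, 7 ≤ m → centralizerCount 7 m [1] =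
      m.choose 1 + 33 * m.choose 2 + 178 * m.choose 3 + 262 * m.choose 4
        + 131 * m.choose 5 + m.choose 6) ∧
    (∀ m : ℕ, 8 ≤ m → centralizerCount 8 m [1] =
      m.choose 1 + 68 * m.choose 2 + 549 * m.choose 3 + 1480 * m.choose 4
        + 1405 * m.choose 5 + 428 * m.choose 6 + m.choose 7) := by
  obtain ⟨h1, h2, h3, h4, h5, h6, h7, h8⟩ := natPackedCount_values
  simp only [List.range, List.range.loop, List.map_cons, List.map_nil, List.cons.injEq,
    and_true] at h1 h2 h3 h4 h5 h6 h7 h8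
  -- The packed numbers are coefficients of binom(m-1, j). By Pascal's rule, for n ≥ 2, the j-th one
  -- is the sum of the coefficients of binom(m, j) and binom(m, j+1) in the claim.
  have hpascal : ∀ k : ℕ, (k + 1).choose 1 = k.choose 0 + k.choose 1 ∧
      (k + 1).choose 2 = k.choose 1 + k.choose 2 ∧ (k + 1).choose 3 = k.choose 2 + k.choose 3 ∧
      (k + 1).choose 4 = k.choose 3 + k.choose 4 ∧ (k + 1).choose 5 = k.choose 4 + k.choose 5 ∧
      (k + 1).choose 6 = k.choose 5 + k.choose 6 ∧ (k + 1).choose 7 = k.choose 6 + k.choose 7 :=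
    fun k => ⟨rfl, rfl, rfl, rfl, rfl, rfl, rfl⟩
  refine ⟨?_, ?_, ?_, ?_, ?_, ?_, ?_, ?_⟩ <;>
  · intro m hm
    obtain ⟨k, rfl⟩ : ∃ k, m = k + 1 := ⟨m - 1, by omega⟩
    obtain ⟨c1, c2, c3, c4, c5, c6, c7⟩ := hpascal k
    rw [centralizerCount_one_eq_sum_range hm]
    simp only [Finset.sum_range_succ, Finset.sum_range_zero, packedCount_succ, h1, h2, h3, h4, h5,
      h6, h7, h8, c1, c2, c3, c4, c5, c6, c7, Nat.choose_zero_right]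
    omega
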